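/- Let $n\ge 0$ be an integer and write points of $\mathbb{R}^{n+1}$ as $(t,x)$ with $t\in\mathbb{R}$, $x\in\mathbb{R}^n$. First case. Let $\varphi:\mathbb{R}^{n+1}\to(0,\infty]$ be a positive convex function and let $\beta>n$. Then the function $\phi:\mathbb{R}\to[0,\infty]$ defined by $$\phi(t)=\left(\int_{\mathbb{R}^n}\varphi(t,x)^{-\beta}\,dx\right)^{-\frac{1}{\beta-n}}$$ is convex on $\mathbb{R}$, with the conventions $\infty^{-\beta}=0$, $0^{-1/(\beta-n)}=\infty$ and $\infty^{-1/(\beta-n)}=0$. Second case. Let $\Omega\subset\mathbb{R}^{n+1}$ be a bounded open convex set, let $\varphi:\Omega\to(0,\infty)$ be a positive concave function, and let $\beta\ge 0$ (with $\beta>0$ if $n=0$). Put $\Omega(t)=\{x\in\mathbb{R}^n:(t,x)\in\Omega\}$. Then $\int_{\Omega(t)}\varphi(t,x)^{\beta}\,dx$ is finite for every $t\in\mathbb{R}$, and the function $$\psi(t)=\left(\int_{\Omega(t)}\varphi(t,x)^{\beta}\,dx\right)^{\frac{1}{\beta+n}}$$ is concave on the interval $\{t\in\mathbb{R}:\Omega(t)\neq\emptyset\}$.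 -/

import Mathlib

open MeasureTheory Set
open scoped ENNReal NNReal

/-- The section `Ω(t) = {x ∈ ℝⁿ : (t, x) ∈ Ω}` of a set `Ω ⊆ ℝ × ℝⁿ = ℝⁿ⁺¹`. -/
def slice {n : ℕ} (Ω : Set (ℝ × EuclideanSpace ℝ (Fin n))) (t : ℝ) :
    Set (EuclideanSpace ℝ (Fin n)) :=
  {x | (t, x) ∈ Ω}

/-- `ϕ(t) = (∫_{ℝⁿ} φ(t, x)^{-β} dx)^{-1/(β - n)}`, with values in `[0, ∞]`. In `ℝ≥0∞` a negative
power of `∞` is `0` and a negative power of `0` is `∞`, so the value is `0` where the integral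
diverges and `∞` where it vanishes. -/
noncomputable def marginalConvex {n : ℕ} (φ : ℝ × EuclideanSpace ℝ (Fin n) → ℝ≥0∞) (β : ℝ)
    (t : ℝ) : ℝ≥0∞ :=
  (∫⁻ x : EuclideanSpace ℝ (Fin n), φ (t, x) ^ (-β)) ^ (-(1 / (β - n)))

/-- `ψ(t) = (∫_{Ω(t)} φ(t, x)^β dx)^{1/(β + n)}`. -/
noncomputable def marginalConcave {n : ℕ} (Ω : Set (ℝ × EuclideanSpace ℝ (Fin n)))
    (φ : ℝ × EuclideanSpace ℝ (Fin n) → ℝ) (β : ℝ) (t : ℝ) : ℝ :=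
  (∫ x in slice Ω t, φ (t, x) ^ β) ^ (1 / (β + n))

/-! Both cases follow from the Borell–Brascamp–Lieb inequality `powerMean_lintegral_euclidean_le`: a
bound by h(ax + by) on the σ-mean of f(x) and g(y) integrates to a bound by ∫h on the (σ + n)-mean
of ∫f and ∫g. Convexity of φ supplies the pointwise bound for φ^(-β) with σ = -β; concavity supplies
it for φ^β, extended by zero, with σ = β.

Each integration raises σ by one, so induction reduces the inequality to the line. There f and g are
rescaled to supremum 1, their superlevel sets are compared by one-dimensional Brunn–Minkowski, and
the Hölder-type inequality `powerMean.add_one_le_mul` turns the resulting linear bound into a power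
mean. The condition σ < -n or σ ≥ 0 keeps t^(σ + 1) convex at every stage. -/

/-! ### Scalar inequalities for power means -/

theorem rpow_add_le_of_le_zero_or_one_le {τ x y w v : ℝ} (hτ : τ ≤ 0 ∨ 1 ≤ τ) (hx : 0 < x)
    (hy : 0 < y) (hw : 0 ≤ w) (hv : 0 ≤ v) (hwv : w + v = 1) :
    (w * x + v * y) ^ τ ≤ w * x ^ τ + v * y ^ τ := by
  rcases hτ with hτ | hτ
  · have hpos : 0 < w * x + v * y := by
      rcases hw.eq_or_lt with rfl | hw
      · simpa [show v = 1 by linarith] using hy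
      · positivity
    have hlog := strictConcaveOn_log_Ioi.concaveOn.2 hx hy hw hv hwv
    have hexp := convexOn_exp.2 (mem_univ (Real.log x * τ)) (mem_univ (Real.log y * τ)) hw hv hwv
    simp only [smul_eq_mul] at hlog hexp
    rw [Real.rpow_def_of_pos hpos, Real.rpow_def_of_pos hx, Real.rpow_def_of_pos hy]
    refine le_trans (Real.exp_le_exp.2 ?_) hexp
    nlinarith
  · exact (convexOn_rpow hτ).2 hx.le hy.le hw hv hwv

/-- Jensen for t^(σ + 1), at the points A/p and B/q with weights proportional to ap and bq. No
normalisation a + b = 1 is needed. -/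
theorem power_mean_le_mul_of_pos {σ a b p q I J : ℝ} (hσ : σ < -1 ∨ 0 < σ) (ha : 0 < a)
    (hb : 0 < b) (hp : 0 < p) (hq : 0 < q) (hI : 0 < I) (hJ : 0 < J) :
    (a * I ^ (σ + 1)⁻¹ + b * J ^ (σ + 1)⁻¹) ^ (σ + 1) ≤
      (a * p + b * q) ^ σ * (a * (I / p ^ σ) + b * (J / q ^ σ)) := by
  have hτ0 : σ + 1 ≠ 0 := by rcases hσ with h | h <;> linarith
  have hS : 0 < a * p + b * q := by positivity
  set S := a * p + b * q with hSdef
  set A := I ^ (σ + 1)⁻¹ with hA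
  set B := J ^ (σ + 1)⁻¹ with hB
  have hA0 : 0 < A := by positivity
  have hB0 : 0 < B := by positivity
  have hIA : I = A ^ (σ + 1) := by rw [hA, Real.rpow_inv_rpow hI.le hτ0]
  have hJB : J = B ^ (σ + 1) := by rw [hB, Real.rpow_inv_rpow hJ.le hτ0]
  have key := rpow_add_le_of_le_zero_or_one_le (τ := σ + 1) (x := A / p) (y := B / q)
    (w := a * p / S) (v := b * q / S)
    (by rcases hσ with h | h; exacts [Or.inl (by linarith), Or.inr (by linarith)])
    (by positivity) (by positivity) (by positivity) (by positivity)
    (by rw [← add_div, ← hSdef, div_self hS.ne'])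
  have e1 : a * p / S * (A / p) + b * q / S * (B / q) = (a * A + b * B) / S := by
    field_simp
  have e2 : ∀ {X r : ℝ}, 0 < X → 0 < r → r * (X / r) ^ (σ + 1) = X ^ (σ + 1) / r ^ σ := by
    intro X r hX hr
    rw [Real.div_rpow hX.le hr.le, Real.rpow_add_one hr.ne']
    field_simp
  have e3 : a * p / S * (A / p) ^ (σ + 1) + b * q / S * (B / q) ^ (σ + 1) =
      (a * (I / p ^ σ) + b * (J / q ^ σ)) / S := by
    rw [hIA, hJB, ← e2 hA0 hp, ← e2 hB0 hq]
    ring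
  rw [e1, e3, Real.div_rpow (by positivity) hS.le, div_le_iff₀ (by positivity)] at key
  refine key.trans_eq ?_
  rw [Real.rpow_add_one hS.ne']
  field_simp

/-- The mean `(a u^{1/σ} + b v^{1/σ})^σ` on `[0, ∞]`, read as `max u v` for `σ = 0`. -/
noncomputable def powerMean (a b : ℝ≥0) (σ : ℝ) (u v : ℝ≥0∞) : ℝ≥0∞ :=
  if σ = 0 then max u v else (a * u ^ σ⁻¹ + b * v ^ σ⁻¹) ^ σ

namespace powerMean

variable {a b : ℝ≥0} {σ : ℝ} {u v u' v' : ℝ≥0∞}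

theorem zero : powerMean a b 0 u v = max u v := if_pos rfl

theorem of_ne_zero (hσ : σ ≠ 0) : powerMean a b σ u v = (a * u ^ σ⁻¹ + b * v ^ σ⁻¹) ^ σ :=
  if_neg hσ

theorem rpow_antitone {z : ℝ} (hz : z ≤ 0) {x y : ℝ≥0∞} (h : x ≤ y) : y ^ z ≤ x ^ z := by
  rw [← neg_neg z, ENNReal.rpow_neg, ENNReal.rpow_neg x]
  exact ENNReal.inv_le_inv.2 (ENNReal.rpow_le_rpow h (neg_nonneg.2 hz))

theorem mul_rpow_left {c : ℝ≥0∞} (hc0 : c ≠ 0) (hc : c ≠ ∞) (x : ℝ≥0∞) (z : ℝ) :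
    (c * x) ^ z = c ^ z * x ^ z := by
  simp [ENNReal.mul_rpow_eq_ite, hc0, hc]

theorem mono (hu : u ≤ u') (hv : v ≤ v') : powerMean a b σ u v ≤ powerMean a b σ u' v' := by
  -- For σ < 0 the inner and outer powers both reverse order, and the reversals cancel.
  rcases lt_trichotomy σ 0 with h | rfl | h
  · rw [of_ne_zero h.ne, of_ne_zero h.ne]
    apply rpow_antitone h.le
    exact add_le_add (mul_le_mul_right (rpow_antitone (inv_nonpos.2 h.le) hu) _)
      (mul_le_mul_right (rpow_antitone (inv_nonpos.2 h.le) hv) _)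
  · rw [zero, zero]
    exact max_le_max hu hv
  · rw [of_ne_zero h.ne', of_ne_zero h.ne']
    gcongr

theorem smul {c : ℝ≥0∞} (hc0 : c ≠ 0) (hc : c ≠ ∞) :
    powerMean a b σ (c * u) (c * v) = c * powerMean a b σ u v := by
  rcases eq_or_ne σ 0 with rfl | h
  · rw [zero, zero, mul_max]
  · rw [of_ne_zero h, of_ne_zero h, mul_rpow_left hc0 hc, mul_rpow_left hc0 hc, mul_left_comm,
      mul_left_comm (b : ℝ≥0∞), ← mul_add, mul_rpow_left
        (ENNReal.rpow_pos hc0.bot_lt hc).ne' (ENNReal.rpow_ne_top_of_ne_zero hc0 hc),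
      ENNReal.rpow_inv_rpow h]

theorem continuous : Continuous fun p : ℝ≥0∞ × ℝ≥0∞ => powerMean a b σ p.1 p.2 := by
  rcases eq_or_ne σ 0 with rfl | h
  · simp only [zero]
    fun_prop
  · simp only [of_ne_zero h]
    refine ENNReal.continuous_rpow_const.comp (Continuous.add ?_ ?_)
    · exact (ENNReal.continuous_const_mul ENNReal.coe_ne_top).comp
        (ENNReal.continuous_rpow_const.comp continuous_fst)
    · exact (ENNReal.continuous_const_mul ENNReal.coe_ne_top).comp
        (ENNReal.continuous_rpow_const.comp continuous_snd)

theorem ne_zero_and_ne_top (ha : 0 < a) (hu0 : u ≠ 0) (hu : u ≠ ∞) (hv0 : v ≠ 0)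
    (hv : v ≠ ∞) : powerMean a b σ u v ≠ 0 ∧ powerMean a b σ u v ≠ ∞ := by
  rcases eq_or_ne σ 0 with rfl | h
  · rw [zero]
    exact ⟨(lt_max_of_lt_left hu0.bot_lt).ne', (max_lt hu.lt_top hv.lt_top).ne⟩
  · rw [of_ne_zero h]
    have h1 : (a : ℝ≥0∞) * u ^ σ⁻¹ + b * v ^ σ⁻¹ ≠ 0 := by
      have : (a : ℝ≥0∞) * u ^ σ⁻¹ ≠ 0 :=
        mul_ne_zero (by exact_mod_cast ha.ne') (ENNReal.rpow_pos hu0.bot_lt hu).ne'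
      simp [this]
    have h2 : (a : ℝ≥0∞) * u ^ σ⁻¹ + b * v ^ σ⁻¹ ≠ ∞ :=
      ENNReal.add_ne_top.2 ⟨ENNReal.mul_ne_top ENNReal.coe_ne_top (ENNReal.rpow_ne_top_of_ne_zero hu0 hu),
        ENNReal.mul_ne_top ENNReal.coe_ne_top (ENNReal.rpow_ne_top_of_ne_zero hv0 hv)⟩
    exact ⟨(ENNReal.rpow_pos h1.bot_lt h2).ne', ENNReal.rpow_ne_top_of_ne_zero h1 h2⟩

theorem ofReal {x y : ℝ} (ha : 0 < a) (hb : 0 < b) (hσ : σ ≠ 0) (hx : 0 < x) (hy : 0 < y) :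
    powerMean a b σ (ENNReal.ofReal x) (ENNReal.ofReal y) =
      ENNReal.ofReal ((a * x ^ σ⁻¹ + b * y ^ σ⁻¹) ^ σ) := by
  have ha' : (0 : ℝ) < a := ha
  have hb' : (0 : ℝ) < b := hb
  rw [of_ne_zero hσ, ENNReal.ofReal_rpow_of_pos hx, ENNReal.ofReal_rpow_of_pos hy,
    ← ENNReal.ofReal_coe_nnreal, ← ENNReal.ofReal_coe_nnreal, ← ENNReal.ofReal_mul ha'.le,
    ← ENNReal.ofReal_mul hb'.le, ← ENNReal.ofReal_add (by positivity) (by positivity),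
    ENNReal.ofReal_rpow_of_pos (by positivity)]

/-- Used with F, G the suprema and I, J the integrals of two functions: it undoes the normalisation
by suprema. -/
theorem add_one_le_mul (hσ : σ < -1 ∨ 0 ≤ σ) (ha : 0 < a) (hb : 0 < b) {F G I J : ℝ≥0∞}
    (hF0 : F ≠ 0) (hF : F ≠ ∞) (hG0 : G ≠ 0) (hG : G ≠ ∞) (hI : I ≠ 0) (hJ : J ≠ 0) :
    powerMean a b (σ + 1) I J ≤ powerMean a b σ F G * (a * (I / F) + b * (J / G)) := by
  have ha' : (a : ℝ≥0∞) ≠ 0 := by exact_mod_cast ha.ne'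
  have hb' : (b : ℝ≥0∞) ≠ 0 := by exact_mod_cast hb.ne'
  have hM := (ne_zero_and_ne_top (b := b) (σ := σ) ha hF0 hF hG0 hG).1
  rcases eq_or_ne I ∞ with rfl | hI'
  · rw [ENNReal.top_div_of_ne_top hF, ENNReal.mul_top ha', top_add, ENNReal.mul_top hM]
    exact le_top
  rcases eq_or_ne J ∞ with rfl | hJ'
  · rw [ENNReal.top_div_of_ne_top hG, ENNReal.mul_top hb', add_top, ENNReal.mul_top hM]
    exact le_top
  rcases eq_or_ne σ 0 with rfl | hσ0
  · rw [of_ne_zero (by norm_num), zero]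
    simp only [zero_add, inv_one, ENNReal.rpow_one]
    rw [mul_add, mul_left_comm, mul_left_comm _ (b : ℝ≥0∞)]
    gcongr
    · rw [← mul_div_assoc, ENNReal.le_div_iff_mul_le (.inl hF0) (.inl hF), mul_comm]
      gcongr
      exact le_max_left _ _
    · rw [← mul_div_assoc, ENNReal.le_div_iff_mul_le (.inl hG0) (.inl hG), mul_comm]
      gcongr
      exact le_max_right _ _
  have hσ' : σ < -1 ∨ 0 < σ := hσ.imp_right fun h => h.lt_of_ne' hσ0
  have lift : ∀ {x : ℝ≥0∞}, x ≠ 0 → x ≠ ∞ → ∃ r : ℝ, 0 < r ∧ x = ENNReal.ofReal r :=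
    fun {x} h0 h => ⟨x.toReal, ENNReal.toReal_pos h0 h, (ENNReal.ofReal_toReal h).symm⟩
  obtain ⟨F, hFp, rfl⟩ := lift hF0 hF
  obtain ⟨G, hGp, rfl⟩ := lift hG0 hG
  obtain ⟨I, hIp, rfl⟩ := lift hI hI'
  obtain ⟨J, hJp, rfl⟩ := lift hJ hJ'
  have ha₁ : (0 : ℝ) < a := ha
  have hb₁ : (0 : ℝ) < b := hb
  rw [ofReal ha hb (by rcases hσ' with h | h <;> linarith) hIp hJp, ofReal ha hb hσ0 hFp hGp,
    ← ENNReal.ofReal_div_of_pos hFp, ← ENNReal.ofReal_div_of_pos hGp,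
    ← ENNReal.ofReal_coe_nnreal, ← ENNReal.ofReal_coe_nnreal, ← ENNReal.ofReal_mul ha₁.le,
    ← ENNReal.ofReal_mul hb₁.le, ← ENNReal.ofReal_add (by positivity) (by positivity),
    ← ENNReal.ofReal_mul (by positivity)]
  apply ENNReal.ofReal_le_ofReal
  have := power_mean_le_mul_of_pos hσ' ha₁ hb₁ (Real.rpow_pos_of_pos hFp σ⁻¹)
    (Real.rpow_pos_of_pos hGp σ⁻¹) hIp hJp
  rwa [Real.rpow_inv_rpow hFp.le hσ0, Real.rpow_inv_rpow hGp.le hσ0] at this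

end powerMean

/-! ### Brunn–Minkowski and Borell–Brascamp–Lieb on the line -/

open scoped Pointwise in
theorem volume_add_le_of_isCompact {K L S : Set ℝ} (hK : IsCompact K) (hL : IsCompact L)
    (hK0 : K.Nonempty) (hL0 : L.Nonempty) {a b : ℝ≥0} (ha : 0 < a) (hb : 0 < b)
    (hS : ∀ x ∈ K, ∀ y ∈ L, a * x + b * y ∈ S) :
    a * volume K + b * volume L ≤ volume S := by
  obtain ⟨M, hMK, hM⟩ := hK.exists_isGreatest hK0
  obtain ⟨m, hmL, hm⟩ := hL.exists_isLeast hL0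
  have ha' : (a : ℝ) ≠ 0 := by exact_mod_cast ha.ne'
  have hb' : (b : ℝ) ≠ 0 := by exact_mod_cast hb.ne'
  -- The copies aK + b min L and a max K + bL both lie in S and share only the point a max K + b min
  -- L, so their volumes add.
  set A := (fun x : ℝ => a * x + b * m) '' K with hA
  set B := (fun y : ℝ => a * M + b * y) '' L with hB
  have vol : ∀ (c : ℝ≥0) (d : ℝ) (T : Set ℝ),
      volume ((fun x : ℝ => c * x + d) '' T) = c * volume T := by
    intro c d T
    have : (fun x : ℝ => c * x + d) '' T = (fun x => x + d) '' ((c : ℝ) • T) := by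
      rw [← image_smul, image_image]
      rfl
    rw [this, image_add_right, measure_preimage_add_right, Measure.addHaar_smul]
    simp
  have hAv : volume A = a * volume K := vol a _ K
  have hBv : volume B = b * volume L := by
    rw [← vol b (a * M) L, hB]
    simp_rw [add_comm]
  have hBm : MeasurableSet B := (hL.image (by fun_prop)).measurableSet
  have hAB : volume (A ∩ B) = 0 := by
    refine measure_mono_null (t := {a * M + b * m}) ?_ (by simp)
    rintro z ⟨⟨x, hx, rfl⟩, y, hy, hxy⟩
    have h1 : (a : ℝ) * x ≤ a * M := mul_le_mul_of_nonneg_left (hM hx) a.2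
    have h2 : (b : ℝ) * m ≤ b * y := mul_le_mul_of_nonneg_left (hm hy) b.2
    simp only [mem_singleton_iff] at hxy ⊢
    linarith
  have hU := measure_union_add_inter A hBm (μ := volume)
  rw [hAB, add_zero, hAv, hBv] at hU
  rw [← hU]
  apply measure_mono
  rintro z (⟨x, hx, rfl⟩ | ⟨y, hy, rfl⟩)
  · exact hS x hx m hmL
  · exact hS M hMK y hy

/-- The one-dimensional Brunn–Minkowski inequality. -/
theorem volume_add_le {A B S : Set ℝ} (hA : MeasurableSet A) (hB : MeasurableSet B)
    (hA0 : A.Nonempty) (hB0 : B.Nonempty) {a b : ℝ≥0} (ha : 0 < a) (hb : 0 < b)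
    (hS : ∀ x ∈ A, ∀ y ∈ B, a * x + b * y ∈ S) :
    a * volume A + b * volume B ≤ volume S := by
  have approx : ∀ {T : Set ℝ}, MeasurableSet T → T.Nonempty → ∀ r < volume T,
      ∃ K ⊆ T, IsCompact K ∧ K.Nonempty ∧ r ≤ volume K := by
    rintro T hT ⟨t, ht⟩ r hr
    obtain ⟨K, hKT, hK, hrK⟩ := hT.exists_lt_isCompact hr
    exact ⟨insert t K, insert_subset ht hKT, hK.insert t, insert_nonempty _ _,
      hrK.le.trans (measure_mono (subset_insert _ _))⟩
  have approx' : ∀ {T : Set ℝ}, MeasurableSet T → T.Nonempty →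
      volume T = ⨆ K : {K : Set ℝ // K ⊆ T ∧ IsCompact K ∧ K.Nonempty}, volume K.1 := by
    intro T hT hT0
    refine le_antisymm (le_of_forall_lt fun r hr => ?_) (iSup_le fun K => measure_mono K.2.1)
    obtain ⟨r', hr, hr'⟩ := exists_between hr
    obtain ⟨K, h1, h2, h3, h4⟩ := approx hT hT0 r' hr'
    exact hr.trans_le (h4.trans (le_iSup_of_le ⟨K, h1, h2, h3⟩ le_rfl))
  rw [approx' hA hA0, approx' hB hB0, ENNReal.mul_iSup, ENNReal.mul_iSup]
  have : Nonempty {K : Set ℝ // K ⊆ A ∧ IsCompact K ∧ K.Nonempty} :=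
    ⟨{hA0.some}, by simpa using hA0.some_mem, isCompact_singleton, singleton_nonempty _⟩
  have : Nonempty {K : Set ℝ // K ⊆ B ∧ IsCompact K ∧ K.Nonempty} :=
    ⟨{hB0.some}, by simpa using hB0.some_mem, isCompact_singleton, singleton_nonempty _⟩
  refine ENNReal.iSup_add_iSup_le ?_
  rintro ⟨K, hKA, hK, hK0⟩ ⟨L, hLB, hL, hL0⟩
  exact volume_add_le_of_isCompact hK hL hK0 hL0 ha hb
    fun x hx y hy => hS x (hKA hx) y (hLB hy)

theorem lintegral_eq_setLIntegral_Ioi_meas_lt {α : Type*} [MeasurableSpace α] (μ : Measure α)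
    {f : α → ℝ≥0∞} (hf : Measurable f) (hf' : ∀ x, f x ≠ ∞) :
    ∫⁻ x, f x ∂μ = ∫⁻ t in Ioi (0 : ℝ), μ {x | ENNReal.ofReal t < f x} := by
  have := lintegral_eq_lintegral_meas_lt μ (f := fun x => (f x).toReal)
    (ae_of_all _ fun x => ENNReal.toReal_nonneg) hf.ennreal_toReal.aemeasurable
  simp only [ENNReal.ofReal_toReal (hf' _)] at this
  rw [this]
  refine setLIntegral_congr_fun measurableSet_Ioi fun t ht => ?_
  simp only [ENNReal.ofReal_lt_iff_lt_toReal (le_of_lt ht) (hf' _)]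

/-- Layer cake: since both suprema are 1, the superlevel sets of f and g are nonempty for the same
levels t < 1, and there Brunn–Minkowski applies. -/
theorem lintegral_add_le_of_min_le {f g h : ℝ → ℝ≥0∞} (hf : Measurable f) (hg : Measurable g)
    (hh : Measurable h) (hf1 : ⨆ x, f x = 1) (hg1 : ⨆ x, g x = 1) {a b : ℝ≥0} (ha : 0 < a)
    (hb : 0 < b) (H : ∀ x y, min (f x) (g y) ≤ h (a * x + b * y)) :
    a * (∫⁻ x, f x) + b * (∫⁻ x, g x) ≤ ∫⁻ x, h x := by
  have hfl : ∀ x, f x ≤ 1 := fun x => hf1 ▸ le_iSup f x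
  have hgl : ∀ x, g x ≤ 1 := fun x => hg1 ▸ le_iSup g x
  calc a * (∫⁻ x, f x) + b * (∫⁻ x, g x)
      = ∫⁻ t in Ioi (0 : ℝ), (a * volume {x | ENNReal.ofReal t < f x} +
          b * volume {x | ENNReal.ofReal t < g x}) := by
        have anti : ∀ k : ℝ → ℝ≥0∞, Measurable fun t : ℝ => volume {x | ENNReal.ofReal t < k x} :=
          fun k => Antitone.measurable fun s t hst => measure_mono fun x hx =>
            (ENNReal.ofReal_le_ofReal hst).trans_lt hx
        rw [lintegral_add_left ((anti f).const_mul _), lintegral_const_mul _ (anti f),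
          lintegral_const_mul _ (anti g),
          lintegral_eq_setLIntegral_Ioi_meas_lt _ hf fun x => ((hfl x).trans_lt ENNReal.one_lt_top).ne,
          lintegral_eq_setLIntegral_Ioi_meas_lt _ hg fun x => ((hgl x).trans_lt ENNReal.one_lt_top).ne]
    -- Capping h at 1 makes it finite, as the layer cake formula requires, and loses nothing at
    -- levels below 1.
    _ ≤ ∫⁻ t in Ioi (0 : ℝ), volume {x | ENNReal.ofReal t < min (h x) 1} := by
        refine lintegral_mono fun t => ?_
        rcases lt_or_ge (ENNReal.ofReal t) 1 with ht | ht
        · refine volume_add_le (measurableSet_lt measurable_const hf)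
            (measurableSet_lt measurable_const hg) (lt_iSup_iff.1 (hf1.symm ▸ ht) : ∃ x, _ < f x)
            (lt_iSup_iff.1 (hg1.symm ▸ ht) : ∃ x, _ < g x) ha hb fun x hx y hy => ?_
          exact lt_min ((lt_min hx hy).trans_le (H x y)) ht
        · have e : ∀ k : ℝ → ℝ≥0∞, (∀ x, k x ≤ 1) → {x | ENNReal.ofReal t < k x} = ∅ :=
            fun k hk => eq_empty_of_forall_notMem fun x hx => (hx.trans_le ((hk x).trans ht)).false
          rw [e f hfl, e g hgl]
          simp
    _ = ∫⁻ x, min (h x) 1 := by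
        rw [lintegral_eq_setLIntegral_Ioi_meas_lt _ (hh.min measurable_const)]
        exact fun x => ((min_le_right _ _).trans_lt ENNReal.one_lt_top).ne
    _ ≤ ∫⁻ x, h x := lintegral_mono fun x => min_le_left _ _

theorem powerMean_lintegral_le_of_bounded {f g h : ℝ → ℝ≥0∞} (hf : Measurable f)
    (hg : Measurable g) (hh : Measurable h) (hfb : ⨆ x, f x ≠ ∞) (hgb : ⨆ x, g x ≠ ∞)
    {a b : ℝ≥0} (ha : 0 < a) (hb : 0 < b) {σ : ℝ} (hσ : σ < -1 ∨ 0 ≤ σ)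
    (H : ∀ x y, f x ≠ 0 → g y ≠ 0 → powerMean a b σ (f x) (g y) ≤ h (a * x + b * y))
    (hf0 : ∫⁻ x, f x ≠ 0) (hg0 : ∫⁻ x, g x ≠ 0) :
    powerMean a b (σ + 1) (∫⁻ x, f x) (∫⁻ x, g x) ≤ ∫⁻ x, h x := by
  have hsup : ∀ k : ℝ → ℝ≥0∞, ∫⁻ x, k x ≠ 0 → ⨆ x, k x ≠ 0 := by
    intro k hk hk0
    apply hk
    simp [fun x => le_zero_iff.1 (hk0 ▸ le_iSup k x : k x ≤ 0)]
  have hF0 := hsup f hf0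
  have hG0 := hsup g hg0
  set F := ⨆ x, f x with hF
  set G := ⨆ x, g x with hG
  obtain ⟨hM0, hM⟩ := powerMean.ne_zero_and_ne_top (a := a) (b := b) (σ := σ) ha hF0 hfb hG0 hgb
  set M := powerMean a b σ F G with hMdef
  refine (powerMean.add_one_le_mul hσ ha hb hF0 hfb hG0 hgb hf0 hg0).trans ?_
  rw [← hMdef, mul_comm, ← ENNReal.le_div_iff_mul_le (.inl hM0) (.inl hM)]
  simp only [div_eq_mul_inv]
  rw [← lintegral_mul_const _ hf, ← lintegral_mul_const _ hg, ← lintegral_mul_const _ hh]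
  refine lintegral_add_le_of_min_le (hf.mul_const _) (hg.mul_const _) (hh.mul_const _)
    ?_ ?_ ha hb fun x y => ?_
  · rw [← ENNReal.iSup_mul, ENNReal.mul_inv_cancel hF0 hfb]
  · rw [← ENNReal.iSup_mul, ENNReal.mul_inv_cancel hG0 hgb]
  -- By homogeneity and monotonicity, cM is the mean of cF ≤ f x and cG ≤ g y, hence at most h. If c
  -- = 0 the hypothesis may be unavailable, but the bound is trivial.
  · set c := min (f x * F⁻¹) (g y * G⁻¹) with hc
    rcases eq_or_ne c 0 with h0 | h0
    · rw [h0]; exact zero_le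
    have hcf : c * F ≤ f x := by
      rw [← ENNReal.le_div_iff_mul_le (.inl hF0) (.inl hfb)]
      exact min_le_left _ _
    have hcg : c * G ≤ g y := by
      rw [← ENNReal.le_div_iff_mul_le (.inl hG0) (.inl hgb)]
      exact min_le_right _ _
    have hc1 : c ≠ ∞ := by
      refine ((min_le_left _ _).trans_lt (ENNReal.mul_lt_top ?_ ?_)).ne
      · exact (le_iSup f x).trans_lt hfb.lt_top
      · exact ENNReal.inv_lt_top.2 hF0.bot_lt
    rw [← div_eq_mul_inv, ENNReal.le_div_iff_mul_le (.inl hM0) (.inl hM), hMdef,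
      ← powerMean.smul h0 hc1]
    refine (powerMean.mono hcf hcg).trans (H x y ?_ ?_)
    · exact ((mul_ne_zero h0 hF0).bot_lt.trans_le hcf).ne'
    · exact ((mul_ne_zero h0 hG0).bot_lt.trans_le hcg).ne'

/-- The one-dimensional Borell–Brascamp–Lieb inequality. -/
theorem powerMean_lintegral_le {f g h : ℝ → ℝ≥0∞} (hf : Measurable f)
    (hg : Measurable g) (hh : Measurable h)
    {a b : ℝ≥0} (ha : 0 < a) (hb : 0 < b) {σ : ℝ} (hσ : σ < -1 ∨ 0 ≤ σ)
    (H : ∀ x y, f x ≠ 0 → g y ≠ 0 → powerMean a b σ (f x) (g y) ≤ h (a * x + b * y))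
    (hf0 : ∫⁻ x, f x ≠ 0) (hg0 : ∫⁻ x, g x ≠ 0) :
    powerMean a b (σ + 1) (∫⁻ x, f x) (∫⁻ x, g x) ≤ ∫⁻ x, h x := by
  -- Truncation at n reduces to bounded functions: it only lowers f and g, so the hypothesis
  -- persists, and the limit is recovered by monotone convergence and continuity of the mean.
  have trunc : ∀ {k : ℝ → ℝ≥0∞}, Measurable k → Filter.Tendsto
      (fun n : ℕ => ∫⁻ x, min (k x) n) Filter.atTop (nhds (∫⁻ x, k x)) := by
    intro k hk
    refine lintegral_tendsto_of_tendsto_of_monotone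
      (fun n => (hk.min measurable_const).aemeasurable)
      (ae_of_all _ fun x m n hmn => min_le_min le_rfl (by exact_mod_cast hmn))
      (ae_of_all _ fun x => ?_)
    simpa using (tendsto_const_nhds (x := k x)).min ENNReal.tendsto_nat_nhds_top
  have hlim := (powerMean.continuous (a := a) (b := b) (σ := σ + 1)).tendsto
    (∫⁻ x, f x, ∫⁻ x, g x) |>.comp ((trunc hf).prodMk_nhds (trunc hg))
  refine le_of_tendsto hlim ?_
  filter_upwards [(trunc hf).eventually_ne hf0, (trunc hg).eventually_ne hg0] with n hfn hgn
  have hb' : ∀ k : ℝ → ℝ≥0∞, ⨆ x, min (k x) (n : ℝ≥0∞) ≠ ∞ := fun k =>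
    ((iSup_le fun x => min_le_right _ _).trans_lt (ENNReal.natCast_lt_top n)).ne
  refine powerMean_lintegral_le_of_bounded (hf.min measurable_const) (hg.min measurable_const) hh
    (hb' f) (hb' g) ha hb hσ (fun x y hx hy => ?_) hfn hgn
  refine (powerMean.mono (min_le_left _ _) (min_le_left _ _)).trans (H x y ?_ ?_)
  · exact fun h => hx (by simp [h])
  · exact fun h => hy (by simp [h])

/-! ### Borell–Brascamp–Lieb in dimension n -/

theorem lintegral_fin_cons {n : ℕ} {k : (Fin (n + 1) → ℝ) → ℝ≥0∞} (hk : Measurable k) :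
    ∫⁻ z, k z = ∫⁻ x : Fin n → ℝ, ∫⁻ s : ℝ, k (Fin.cons s x) := by
  have hmp := (volume_preserving_piFinSuccAbove (fun _ : Fin (n + 1) => ℝ) 0).symm
  rw [← hmp.lintegral_comp hk, Measure.volume_eq_prod, lintegral_prod_symm']
  · simp only [MeasurableEquiv.piFinSuccAbove_symm_apply, Fin.insertNthEquiv_zero]
    rfl
  · exact hk.comp (MeasurableEquiv.measurable _)

theorem measurable_fin_cons {n : ℕ} :
    Measurable fun p : (Fin n → ℝ) × ℝ => (Fin.cons p.2 p.1 : Fin (n + 1) → ℝ) := by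
  refine measurable_pi_iff.2 fun i => ?_
  refine Fin.cases ?_ (fun j => ?_) i
  · simpa using measurable_snd
  · simpa using! (measurable_pi_apply j).comp measurable_fst

/-- The Borell–Brascamp–Lieb inequality for measurable functions on `ℝⁿ`. -/
theorem powerMean_lintegral_pi_le {n : ℕ} {f g h : (Fin n → ℝ) → ℝ≥0∞} (hf : Measurable f)
    (hg : Measurable g) (hh : Measurable h)
    {a b : ℝ≥0} (ha : 0 < a) (hb : 0 < b) {σ : ℝ} (hσ : σ < -n ∨ 0 ≤ σ)
    (H : ∀ x y, f x ≠ 0 → g y ≠ 0 →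
      powerMean a b σ (f x) (g y) ≤ h ((a : ℝ) • x + (b : ℝ) • y))
    (hf0 : ∫⁻ x, f x ≠ 0) (hg0 : ∫⁻ x, g x ≠ 0) :
    powerMean a b (σ + n) (∫⁻ x, f x) (∫⁻ x, g x) ≤ ∫⁻ x, h x := by
  induction n generalizing σ with
  | zero =>
    simp only [Measure.volume_pi_eq_dirac (0 : Fin 0 → ℝ), lintegral_dirac] at hf0 hg0 ⊢
    simpa using H 0 0 hf0 hg0
  | succ n ih =>
    have meas : ∀ {k : (Fin (n + 1) → ℝ) → ℝ≥0∞}, Measurable k → ∀ x : Fin n → ℝ,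
        Measurable fun s : ℝ => k (Fin.cons s x) := fun hk x =>
      hk.comp (measurable_fin_cons.comp measurable_prodMk_left)
    have meas' : ∀ {k : (Fin (n + 1) → ℝ) → ℝ≥0∞}, Measurable k →
        Measurable fun x : Fin n → ℝ => ∫⁻ s : ℝ, k (Fin.cons s x) := fun hk =>
      (hk.comp measurable_fin_cons).lintegral_prod_right'
    rw [lintegral_fin_cons hf] at hf0 ⊢
    rw [lintegral_fin_cons hg] at hg0 ⊢
    rw [lintegral_fin_cons hh]
    push_cast at hσ
    -- The one-dimensional inequality on fibres gives the pointwise hypothesis, with parameter σ +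
    -- 1, for the fibre integrals.
    have := ih (σ := σ + 1) (meas' hf) (meas' hg) (meas' hh) (hσ.imp (by intro; linarith)
      (by intro; linarith)) ?_ hf0 hg0
    · convert this using 2
      push_cast
      ring
    intro x y hx hy
    refine powerMean_lintegral_le (meas hf x) (meas hg y) (meas hh _) ha hb
      (hσ.imp (fun h => ?_) id) ?_ hx hy
    · have : (0 : ℝ) ≤ n := n.cast_nonneg
      linarith
    · intro s t hs ht
      refine (H _ _ hs ht).trans_eq (congrArg h ?_)
      funext i
      refine Fin.cases ?_ (fun j => ?_) i <;> simp

/-- The majorant must hold everywhere, since the hypothesis on h is pointwise; the value ∞ on a null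
set achieves this. -/
theorem exists_measurable_ge_lintegral_eq {α : Type*} [MeasurableSpace α] {μ : Measure α}
    {h : α → ℝ≥0∞} (hh : AEMeasurable h μ) :
    ∃ k, Measurable k ∧ h ≤ k ∧ ∫⁻ x, k x ∂μ = ∫⁻ x, h x ∂μ := by
  obtain ⟨T, hT, hTm, hT0⟩ := exists_measurable_superset_of_null hh.ae_eq_mk
  classical
  refine ⟨T.piecewise (fun _ => ∞) (hh.mk h), measurable_const.piecewise hTm hh.measurable_mk,
    fun x => ?_, lintegral_congr_ae ?_⟩
  · by_cases hx : x ∈ T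
    · simp [hx]
    · rw [piecewise_eq_of_notMem _ _ _ hx]
      exact (not_not.1 fun hne => hx (hT hne) : h x = _).le
  · filter_upwards [hh.ae_eq_mk, measure_eq_zero_iff_ae_notMem.1 hT0] with x hx hxT
    rw [piecewise_eq_of_notMem _ _ _ hxT, hx]

/-- The Borell–Brascamp–Lieb inequality. -/
theorem powerMean_lintegral_euclidean_le {n : ℕ} {f g h : EuclideanSpace ℝ (Fin n) → ℝ≥0∞}
    (hh : AEMeasurable h)
    {a b : ℝ≥0} (ha : 0 < a) (hb : 0 < b) {σ : ℝ} (hσ : σ < -n ∨ 0 ≤ σ)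
    (H : ∀ x y, f x ≠ 0 → g y ≠ 0 →
      powerMean a b σ (f x) (g y) ≤ h ((a : ℝ) • x + (b : ℝ) • y))
    (hf0 : ∫⁻ x, f x ≠ 0) (hg0 : ∫⁻ x, g x ≠ 0) :
    powerMean a b (σ + n) (∫⁻ x, f x) (∫⁻ x, g x) ≤ ∫⁻ x, h x := by
  -- Lowering f, g and raising h preserves the hypothesis, so only h needs measurability.
  obtain ⟨f', hf', hff, hfi⟩ := exists_measurable_le_lintegral_eq volume f
  obtain ⟨g', hg', hgg, hgi⟩ := exists_measurable_le_lintegral_eq volume g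
  obtain ⟨h', hh', hhh, hhi⟩ := exists_measurable_ge_lintegral_eq hh
  have hmp := PiLp.volume_preserving_toLp (Fin n)
  rw [hfi, ← hmp.lintegral_comp hf'] at hf0 ⊢
  rw [hgi, ← hmp.lintegral_comp hg'] at hg0 ⊢
  rw [← hhi, ← hmp.lintegral_comp hh']
  refine powerMean_lintegral_pi_le (hf'.comp hmp.measurable) (hg'.comp hmp.measurable)
    (hh'.comp hmp.measurable) ha hb hσ (fun x y hx hy => ?_) hf0 hg0
  refine (powerMean.mono (hff _) (hgg _)).trans ((H _ _ ?_ ?_).trans (hhh _))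
  · exact ((pos_iff_ne_zero.2 hx).trans_le (hff _)).ne'
  · exact ((pos_iff_ne_zero.2 hy).trans_le (hgg _)).ne'

/-! ### The convex case -/

theorem aemeasurable_of_convex_superlevel {E : Type*} [NormedAddCommGroup E] [NormedSpace ℝ E]
    [MeasurableSpace E] [BorelSpace E] [FiniteDimensional ℝ E] (μ : Measure E) [μ.IsAddHaarMeasure]
    {h : E → ℝ≥0∞} (hh : ∀ u, Convex ℝ {x | u < h x}) : AEMeasurable h μ := by
  refine NullMeasurable.aemeasurable ?_
  exact measurable_of_Ioi (α := ℝ≥0∞) (δ := NullMeasurableSpace E μ) fun u =>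
    (hh u).nullMeasurableSet μ

/-- A convex φ is quasiconvex, so φ^(-β) has convex superlevel sets, which are null measurable in
finite dimension. -/
theorem ConvexOn.aemeasurable_rpow_neg {n : ℕ} {φ : ℝ × EuclideanSpace ℝ (Fin n) → ℝ≥0∞}
    (hφ : ConvexOn ℝ≥0 univ φ) {β : ℝ} (hβ : 0 ≤ β) (t : ℝ) :
    AEMeasurable fun x : EuclideanSpace ℝ (Fin n) => φ (t, x) ^ (-β) := by
  refine aemeasurable_of_convex_superlevel _ fun u x hx y hy a b ha hb hab => ?_
  lift a to ℝ≥0 using ha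
  lift b to ℝ≥0 using hb
  have hab' : a + b = 1 := by exact_mod_cast hab
  have hle : φ (t, (a : ℝ) • x + (b : ℝ) • y) ≤ max (φ (t, x)) (φ (t, y)) := by
    have h := hφ.2 (mem_univ (t, x)) (mem_univ (t, y)) (zero_le : 0 ≤ a) (zero_le : 0 ≤ b) hab'
    have e : a • (t, x) + b • (t, y) = (t, (a : ℝ) • x + (b : ℝ) • y) := by
      refine Prod.ext ?_ rfl
      change (a : ℝ) * t + b * t = t
      rw [← add_mul, hab, one_mul]
    rw [e] at h
    refine h.trans ?_
    calc a • φ (t, x) + b • φ (t, y)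
        ≤ a • max (φ (t, x)) (φ (t, y)) + b • max (φ (t, x)) (φ (t, y)) := by
          simp only [ENNReal.smul_def, smul_eq_mul]
          gcongr
          exacts [le_max_left _ _, le_max_right _ _]
      _ = max (φ (t, x)) (φ (t, y)) := by rw [← add_smul, hab', one_smul]
  have := powerMean.rpow_antitone (neg_nonpos.2 hβ) hle
  refine lt_of_lt_of_le ?_ this
  rcases max_choice (φ (t, x)) (φ (t, y)) with h | h <;> rw [h] <;> assumption

theorem convexOn_marginalConvex {n : ℕ} {φ : ℝ × EuclideanSpace ℝ (Fin n) → ℝ≥0∞} {β : ℝ}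
    (hφ : ConvexOn ℝ≥0 univ φ) (hβ : (n : ℝ) < β) : ConvexOn ℝ≥0 univ (marginalConvex φ β) := by
  refine ⟨convex_univ, fun s _ t _ a b _ _ hab => ?_⟩
  rcases eq_or_ne a 0 with rfl | ha
  · rw [zero_add] at hab
    simp [hab]
  rcases eq_or_ne b 0 with rfl | hb
  · rw [add_zero] at hab
    simp [hab]
  have hn : (0 : ℝ) ≤ n := n.cast_nonneg
  have hneg : -(1 / (β - n)) < 0 := by
    have : 0 < β - n := by linarith
    simpa using this
  have ha' : (a : ℝ≥0∞) ≠ 0 := by exact_mod_cast ha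
  have hb' : (b : ℝ≥0∞) ≠ 0 := by exact_mod_cast hb
  simp only [marginalConvex, ENNReal.smul_def, smul_eq_mul]
  -- A vanishing integral makes the right-hand side ∞.
  rcases eq_or_ne (∫⁻ x : EuclideanSpace ℝ (Fin n), φ (s, x) ^ (-β)) 0 with hI | hI
  · rw [hI, ENNReal.zero_rpow_of_neg hneg, ENNReal.mul_top ha', top_add]
    exact le_top
  rcases eq_or_ne (∫⁻ x : EuclideanSpace ℝ (Fin n), φ (t, x) ^ (-β)) 0 with hJ | hJ
  · rw [hJ, ENNReal.zero_rpow_of_neg hneg, ENNReal.mul_top hb', add_top]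
    exact le_top
  have hβ0 : -β ≠ 0 := by linarith
  have key := powerMean_lintegral_euclidean_le (σ := -β)
    (hφ.aemeasurable_rpow_neg (β := β) (by linarith) (a • s + b • t)) (pos_iff_ne_zero.2 ha)
    (pos_iff_ne_zero.2 hb) (Or.inl (by linarith)) (fun x y _ _ => ?_) hI hJ
  · have hτ : -β + n ≠ 0 := by linarith
    have e : -(1 / (β - n)) = (-β + n)⁻¹ := by
      rw [one_div, ← inv_neg]
      congr 1
      ring
    have := powerMean.rpow_antitone hneg.le key
    rw [powerMean.of_ne_zero hτ, e, ENNReal.rpow_rpow_inv hτ] at this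
    rwa [e]
  · rw [powerMean.of_ne_zero hβ0, ENNReal.rpow_rpow_inv hβ0, ENNReal.rpow_rpow_inv hβ0]
    exact powerMean.rpow_antitone (by linarith) (hφ.2 (mem_univ (s, x)) (mem_univ (t, y))
      (zero_le : 0 ≤ a) (zero_le : 0 ≤ b) hab)

/-! ### The concave case -/

theorem ConcaveOn.bddAbove_image_of_isBounded {E : Type*} [NormedAddCommGroup E]
    [NormedSpace ℝ E] {Ω : Set E} {φ : E → ℝ} (hb : Bornology.IsBounded Ω) (ho : IsOpen Ω)
    (hφ : ConcaveOn ℝ Ω φ) (hpos : ∀ p ∈ Ω, 0 < φ p) : ∃ C, ∀ p ∈ Ω, φ p ≤ C := by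
  rcases Ω.eq_empty_or_nonempty with rfl | ⟨p₀, hp₀⟩
  · exact ⟨0, by simp⟩
  obtain ⟨r, hr, hball⟩ := Metric.isOpen_iff.1 ho p₀ hp₀
  obtain ⟨D, hD, hΩ⟩ := hb.subset_ball_lt 0 p₀
  -- With this ratio, p reflects through p₀ to a point q of the ball inside Ω. Then p₀ = (c p +
  -- q)/(1 + c), and concavity with φ(q) > 0 bounds φ(p).
  set c := r / D with hc
  have hc0 : 0 < c := div_pos hr hD
  refine ⟨(1 + c) / c * φ p₀, fun p hp => ?_⟩
  have hq : p₀ - c • (p - p₀) ∈ Ω := by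
    apply hball
    have : ‖p - p₀‖ < D := by simpa [dist_eq_norm] using hΩ hp
    rw [Metric.mem_ball, dist_eq_norm, sub_sub_cancel_left, norm_neg, norm_smul,
      Real.norm_of_nonneg hc0.le]
    calc c * ‖p - p₀‖ < c * D := by gcongr
      _ = r := div_mul_cancel₀ _ hD.ne'
  have h := hφ.2 hp hq (by positivity : 0 ≤ c / (1 + c)) (by positivity : 0 ≤ 1 / (1 + c))
    (by field_simp; ring)
  have e : (c / (1 + c)) • p + (1 / (1 + c)) • (p₀ - c • (p - p₀)) = p₀ := by
    have h1 : (1 + c) • p₀ = c • p + (p₀ - c • (p - p₀)) := by module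
    have h2 : (1 + c) ≠ 0 := by positivity
    rw [div_eq_inv_mul, mul_smul, one_div, ← smul_add, ← h1, inv_smul_smul₀ h2]
  rw [e] at h
  have hq0 : 0 ≤ (1 / (1 + c)) • φ (p₀ - c • (p - p₀)) :=
    smul_nonneg (by positivity) (hpos _ hq).le
  have h3 : c / (1 + c) * φ p ≤ φ p₀ := by
    simp only [smul_eq_mul] at h hq0
    linarith
  rw [div_mul_eq_mul_div, div_le_iff₀ (by positivity)] at h3
  rw [div_mul_eq_mul_div, le_div_iff₀ hc0]
  linarith

section Concave

variable {n : ℕ} {Ω : Set (ℝ × EuclideanSpace ℝ (Fin n))} {φ : ℝ × EuclideanSpace ℝ (Fin n) → ℝ}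
  {β : ℝ}

theorem isOpen_slice (ho : IsOpen Ω) (t : ℝ) : IsOpen (slice Ω t) :=
  ho.preimage (Continuous.prodMk_right t)

theorem integrableOn_slice_rpow (hb : Bornology.IsBounded Ω) (ho : IsOpen Ω)
    (hpos : ∀ p ∈ Ω, 0 < φ p) (hφ : ConcaveOn ℝ Ω φ) (hβ : 0 ≤ β) (t : ℝ) :
    IntegrableOn (fun x => φ (t, x) ^ β) (slice Ω t) := by
  obtain ⟨C, hC⟩ := hφ.bddAbove_image_of_isBounded hb ho hpos
  have hm := (isOpen_slice ho t).measurableSet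
  have hcont : ContinuousOn (fun x => φ (t, x) ^ β) (slice Ω t) :=
    ((hφ.continuousOn ho).comp (Continuous.prodMk_right t).continuousOn fun x hx => hx).rpow_const
      fun x hx => Or.inr hβ
  have hbdd : Bornology.IsBounded (slice Ω t) :=
    hb.image_snd.subset fun x hx => ⟨(t, x), hx, rfl⟩
  refine IntegrableOn.of_bound hbdd.measure_lt_top (hcont.aestronglyMeasurable hm) (C ^ β) ?_
  filter_upwards [ae_restrict_mem hm] with x hx
  rw [Real.norm_of_nonneg (Real.rpow_nonneg (hpos _ hx).le _)]
  exact Real.rpow_le_rpow (hpos _ hx).le (hC _ hx) hβ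

theorem concaveOn_marginalConcave (hb : Bornology.IsBounded Ω) (ho : IsOpen Ω)
    (hpos : ∀ p ∈ Ω, 0 < φ p) (hφ : ConcaveOn ℝ Ω φ) (hβ : 0 ≤ β) (hβn : 0 < β + n) :
    ConcaveOn ℝ {t : ℝ | (slice Ω t).Nonempty} (marginalConcave Ω φ β) := by
  have hcomb : ∀ {s t : ℝ} {x y : EuclideanSpace ℝ (Fin n)} {a b : ℝ}, x ∈ slice Ω s →
      y ∈ slice Ω t → 0 ≤ a → 0 ≤ b → a + b = 1 → a • x + b • y ∈ slice Ω (a • s + b • t) :=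
    fun hx hy ha hb hab => hφ.1 hx hy ha hb hab
  refine ⟨fun s ⟨x, hx⟩ t ⟨y, hy⟩ a b ha hb hab => ⟨_, hcomb hx hy ha hb hab⟩,
    fun s hs t ht a b ha hb' hab => ?_⟩
  rcases ha.eq_or_lt with rfl | ha
  · rw [zero_add] at hab
    simp [hab]
  rcases hb'.eq_or_lt with rfl | hb'
  · rw [add_zero] at hab
    simp [hab]
  -- Extension by zero gives functions on all of ℝⁿ; the hypothesis is tested only at nonzero
  -- values, hence inside the slices.
  set k : ℝ → EuclideanSpace ℝ (Fin n) → ℝ≥0∞ := fun r =>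
    (slice Ω r).indicator fun x => ENNReal.ofReal (φ (r, x) ^ β) with hk
  have hm : ∀ r, MeasurableSet (slice Ω r) := fun r => (isOpen_slice ho r).measurableSet
  have hint := integrableOn_slice_rpow hb ho hpos hφ hβ
  have hkm : ∀ r, AEMeasurable (k r) := fun r =>
    (aemeasurable_indicator_iff (hm r)).2 (hint r).aemeasurable.ennreal_ofReal
  have hkI : ∀ r, ∫⁻ x, k r x = ENNReal.ofReal (∫ x in slice Ω r, φ (r, x) ^ β) := by
    intro r
    rw [lintegral_indicator (hm r), ofReal_integral_eq_lintegral_ofReal (hint r)]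
    filter_upwards [ae_restrict_mem (hm r)] with x hx
    exact Real.rpow_nonneg (hpos _ hx).le _
  have hpos' : ∀ r, (slice Ω r).Nonempty → 0 < ∫ x in slice Ω r, φ (r, x) ^ β := by
    intro r hr
    rw [← ENNReal.ofReal_pos, ← hkI, pos_iff_ne_zero, Ne, lintegral_eq_zero_iff' (hkm r)]
    intro h0
    have : Function.support (k r) = slice Ω r := by
      ext x
      by_cases hx : x ∈ slice Ω r
      · simpa [hk, hx] using Real.rpow_pos_of_pos (hpos _ hx) β
      · simp [hk, hx]
    have h0' : volume (Function.support (k r)) = 0 := ae_iff.1 h0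
    exact ((isOpen_slice ho r).measure_pos _ hr).ne' (this ▸ h0')
  have hI := hpos' s hs
  have hJ := hpos' t ht
  lift a to ℝ≥0 using ha.le
  lift b to ℝ≥0 using hb'.le
  have ha0 : 0 < a := ha
  have hb0 : 0 < b := hb'
  have mem : ∀ r x, k r x ≠ 0 → x ∈ slice Ω r := fun r x h =>
    not_not.1 fun hx => h (indicator_of_notMem hx _)
  have key := powerMean_lintegral_euclidean_le (σ := β) (f := k s) (g := k t)
    (hkm ((a : ℝ) • s + (b : ℝ) • t)) ha0 hb0 (Or.inr hβ) (fun x y hx hy => ?_)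
    (by rw [hkI]; exact (ENNReal.ofReal_pos.2 hI).ne')
    (by rw [hkI]; exact (ENNReal.ofReal_pos.2 hJ).ne')
  · rw [hkI, hkI, hkI, powerMean.ofReal ha0 hb0 hβn.ne' hI hJ,
      ENNReal.ofReal_le_ofReal_iff (integral_nonneg_of_ae ?_)] at key
    · have := Real.rpow_le_rpow (by positivity) key (inv_pos.2 hβn).le
      rw [Real.rpow_rpow_inv (by positivity) hβn.ne'] at this
      simpa only [marginalConcave, smul_eq_mul, one_div] using this
    · filter_upwards [ae_restrict_mem (hm _)] with x hx
      exact Real.rpow_nonneg (hpos _ hx).le _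
  · have hx' := mem _ _ hx
    have hy' := mem _ _ hy
    have hxy := hcomb hx' hy' ha.le hb'.le hab
    simp only [hk, indicator_of_mem hx', indicator_of_mem hy', indicator_of_mem hxy]
    -- For β = 0 the mean is a maximum, and all three values are 1.
    rcases hβ.eq_or_lt with rfl | hβ0
    · simp [powerMean.zero]
    have hp := hpos _ hx'
    have hq := hpos _ hy'
    rw [powerMean.ofReal ha0 hb0 hβ0.ne' (by positivity) (by positivity),
      Real.rpow_rpow_inv hp.le hβ0.ne', Real.rpow_rpow_inv hq.le hβ0.ne']
    exact ENNReal.ofReal_le_ofReal (Real.rpow_le_rpow (by positivity)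
      (hφ.2 hx' hy' ha.le hb'.le hab) hβ)

end Concave

theorem theorem4 (n : ℕ) :
    (∀ (φ : ℝ × EuclideanSpace ℝ (Fin n) → ℝ≥0∞) (β : ℝ),
      (∀ p, 0 < φ p) → ConvexOn ℝ≥0 univ φ → (n : ℝ) < β →
        ConvexOn ℝ≥0 univ (marginalConvex φ β)) ∧
    (∀ (Ω : Set (ℝ × EuclideanSpace ℝ (Fin n))) (φ : ℝ × EuclideanSpace ℝ (Fin n) → ℝ) (β : ℝ),
      Bornology.IsBounded Ω → IsOpen Ω → Convex ℝ Ω →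
      (∀ p ∈ Ω, 0 < φ p) → ConcaveOn ℝ Ω φ → 0 ≤ β → 0 < β + n →
        (∀ t : ℝ, IntegrableOn (fun x => φ (t, x) ^ β) (slice Ω t)) ∧
        ConcaveOn ℝ {t : ℝ | (slice Ω t).Nonempty} (marginalConcave Ω φ β)) :=
  ⟨fun _ _ _ hφ hβ => convexOn_marginalConvex hφ hβ,
    fun _ _ _ hb ho _ hpos hφ hβ hβn => ⟨integrableOn_slice_rpow hb ho hpos hφ hβ,
      concaveOn_marginalConcave hb ho hpos hφ hβ hβn⟩⟩
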